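/- Let \(f\in L^\infty(0,1)\) be such that its left and right approximate limits \[ f^-(x)=\lim_{y\to x^-}\frac1{x-y}\int_y^x f(t)\,dt,\qquad f^+(x)=\lim_{y\to x^+}\frac1{y-x}\int_x^y f(t)\,dt \] exist at every point \(x\in(0,1)\). Let \(F(t)=\int_0^t f(x)\,dx\) for \(t\in[0,1]\). For \(\alpha\in(0,+\infty)\) let \(\mathcal A_\alpha\) be the set of absolutely continuous functions \(U\) on \([0,1]\) with \(U(0)=F(0)=0\), \(U(1)=F(1)\) and \(\sup_{x\in(0,1)}|U(x)-F(x)|\le\alpha\). Let \(U_\alpha\) be the (unique) solution of the taut string problem, that is, the minimizer of \[ \mathcal J[U]=\int_0^1\sqrt{1+U'(x)^2}\,dx \] over \(U\in\mathcal A_\alpha\), and define the upper and lower contact sets \[ C_\alpha^{+}=\{x\in(0,1): U_\alpha(x)=F(x)+\alpha\},\qquad C_\alpha^{-}=\{x\in(0,1): U_\alpha(x)=F(x)-\alpha\}. \] Then for all \(0<\alpha_1<\alpha_2<+\infty\), \[ C_{\alpha_1}^{+}\cup C_{\alpha_1}^{-}\;\supseteq\; C_{\alpha_2}^{+}\cup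 C_{\alpha_2}^{-}. \] -/

import Mathlib

open MeasureTheory Set Filter Topology

namespace TautString

/-- The primitive `F(t) = ∫₀ᵗ f(x) dx` of the input signal. -/
noncomputable def primitive (f : ℝ → ℝ) (t : ℝ) : ℝ :=
  ∫ x in (0 : ℝ)..t, f x

/-- `f` has a left approximate limit at `x`: the averages of `f` over `(y, x)` converge to a real
number as `y → x⁻`. -/
def HasLeftApproxLimit (f : ℝ → ℝ) (x : ℝ) : Prop :=
  ∃ l : ℝ, Tendsto (fun y : ℝ => ⨍ t in y..x, f t) (𝓝[<] x) (𝓝 l)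

/-- `f` has a right approximate limit at `x`: the averages of `f` over `(x, y)` converge to a real
number as `y → x⁺`. -/
def HasRightApproxLimit (f : ℝ → ℝ) (x : ℝ) : Prop :=
  ∃ l : ℝ, Tendsto (fun y : ℝ => ⨍ t in x..y, f t) (𝓝[>] x) (𝓝 l)

/-- The admissible class `𝒜_α`: absolutely continuous functions on the unit interval staying within
distance `α` of the primitive `F` of `f`, with the same boundary values as `F`. An absolutely
continuous function on `(0,1)` is identified with its continuous extension to `[0,1]`. -/
def admissible (f : ℝ → ℝ) (α : ℝ) : Set (ℝ → ℝ) :=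
  {U | AbsolutelyContinuousOnInterval U 0 1 ∧
    (∀ x ∈ Ioo (0 : ℝ) 1, |U x - primitive f x| ≤ α) ∧
    U 0 = 0 ∧ U 1 = primitive f 1}

/-- The length of the graph, `𝒥[U] = ∫₀¹ √(1 + U'(x)²) dx`. If `U` is absolutely continuous, then
`U'` exists almost everywhere and is integrable, and so is the integrand. -/
noncomputable def graphLength (U : ℝ → ℝ) : ℝ :=
  ∫ x in (0 : ℝ)..1, √(1 + deriv U x ^ 2)

/-- `U` is a solution of the taut string problem with input `f` and parameter `α`: it is admissible
and has the smallest graph length among all admissible functions. -/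
def IsTautString (f : ℝ → ℝ) (α : ℝ) (U : ℝ → ℝ) : Prop :=
  U ∈ admissible f α ∧ IsMinOn graphLength (admissible f α) U

/-- The upper contact set `C_α⁺ = {x ∈ (0,1) : U(x) = F(x) + α}`. -/
def upperContactSet (f : ℝ → ℝ) (α : ℝ) (U : ℝ → ℝ) : Set ℝ :=
  {x | x ∈ Ioo (0 : ℝ) 1 ∧ U x = primitive f x + α}

/-- The lower contact set `C_α⁻ = {x ∈ (0,1) : U(x) = F(x) - α}`. -/
def lowerContactSet (f : ℝ → ℝ) (α : ℝ) (U : ℝ → ℝ) : Set ℝ :=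
  {x | x ∈ Ioo (0 : ℝ) 1 ∧ U x = primitive f x - α}

end TautString

/-! The crux is that taut strings `U`, `V` of radii `α`, `β` satisfy `|U - V| ≤ c` with `c = |α -
β|`. Put `P = (U - V - c)⁺ / 2`. Both `U - P` and `V + P` remain admissible for their own radii, and
where `P > 0` both have slope `(U' + V') / 2`. By strict convexity of `√(1 + t²)` the total length
drops unless `P' = 0` a.e.; minimality and `P 0 = 0` then force `P = 0` (`le_add_of_graphLength_le`,
`IsTautString.le_add_abs_sub`). When the radius shrinks by `α₂ - α₁`, the string moves by at most
that amount, so a point on the wall of the wide tube is on the same wall of the narrow one. -/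

/-- Strict midpoint convexity of `t ↦ √(1 + t²)`. -/
theorem Real.sqrt_one_add_sq_midpoint_lt {u v : ℝ} (h : u ≠ v) :
    2 * √(1 + ((u + v) / 2) ^ 2) < √(1 + u ^ 2) + √(1 + v ^ 2) := by
  have hu := Real.sq_sqrt (show 0 ≤ 1 + u ^ 2 by positivity)
  have hv := Real.sq_sqrt (show 0 ≤ 1 + v ^ 2 by positivity)
  have hm := Real.sq_sqrt (show 0 ≤ 1 + ((u + v) / 2) ^ 2 by positivity)
  have hpos : 0 < (u - v) ^ 2 := by have := sub_ne_zero.mpr h; positivity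
  -- The gap between the squares is `(1 + u²)(1 + v²) - (1 + uv)² = (u - v)²`; the sign of `1 + uv`
  -- is irrelevant.
  have hprod : 1 + u * v < √(1 + u ^ 2) * √(1 + v ^ 2) := by
    refine lt_of_pow_lt_pow_left₀ 2 (by positivity) ?_
    rw [mul_pow, hu, hv]
    linarith
  refine lt_of_pow_lt_pow_left₀ 2 (by positivity) ?_
  rw [mul_pow, hm, add_sq, hu, hv]
  linarith

/-- Postcomposition with a Lipschitz function preserves absolute continuity. -/
theorem LipschitzWith.comp_absolutelyContinuousOnInterval {X Y : Type*} [PseudoMetricSpace X]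
    [PseudoMetricSpace Y] {K : NNReal} {g : X → Y} {f : ℝ → X} {a b : ℝ}
    (hg : LipschitzWith K g) (hf : AbsolutelyContinuousOnInterval f a b) :
    AbsolutelyContinuousOnInterval (fun x => g (f x)) a b := by
  unfold AbsolutelyContinuousOnInterval at hf ⊢
  refine squeeze_zero (fun E => Finset.sum_nonneg fun i _ => dist_nonneg) (fun E => ?_)
    (by simpa using hf.const_mul (K : ℝ))
  rw [Finset.mul_sum]
  exact Finset.sum_le_sum fun i _ => hg.dist_le_mul _ _

/-- The arc length integrand of an absolutely continuous function is integrable. -/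
theorem AbsolutelyContinuousOnInterval.intervalIntegrable_sqrt_one_add_deriv_sq {U : ℝ → ℝ}
    {a b : ℝ} (hU : AbsolutelyContinuousOnInterval U a b) :
    IntervalIntegrable (fun x => √(1 + deriv U x ^ 2)) volume a b := by
  refine (intervalIntegrable_const (c := (1 : ℝ)).add hU.intervalIntegrable_deriv.norm).mono_fun
    ?_ (ae_of_all _ fun x => ?_)
  · exact (by fun_prop : Measurable fun x => √(1 + deriv U x ^ 2)).aestronglyMeasurable
  · beta_reduce
    rw [Real.norm_of_nonneg (Real.sqrt_nonneg _), Real.norm_of_nonneg (by positivity),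
      Real.norm_eq_abs]
    refine Real.sqrt_le_iff.mpr ⟨by positivity, ?_⟩
    nlinarith [abs_nonneg (deriv U x), sq_abs (deriv U x)]

theorem AbsolutelyContinuousOnInterval.max_sub_sub_zero_div_two {U V : ℝ → ℝ} {a b : ℝ}
    (hU : AbsolutelyContinuousOnInterval U a b) (hV : AbsolutelyContinuousOnInterval V a b)
    (c : ℝ) : AbsolutelyContinuousOnInterval (fun x => max (U x - V x - c) 0 / 2) a b := by
  have hg : LipschitzWith 1 fun t : ℝ => max (t - c) 0 :=
    (LipschitzWith.of_dist_le_mul fun s t => by simp [Real.dist_eq]).max_const 0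
  have := (hg.comp_absolutelyContinuousOnInterval (hU.sub hV)).const_mul (1 / 2)
  refine (congrArg (AbsolutelyContinuousOnInterval · a b) (funext fun x => ?_)).mp this
  simp only [Pi.sub_apply]
  ring

/-- Half of the positive part of a function has derivative zero where the function is nonpositive,
and half of the derivative of the function where it is positive. -/
theorem deriv_max_zero_div_two {D : ℝ → ℝ} {x : ℝ} (hD : DifferentiableAt ℝ D x) :
    deriv (fun y => max (D y) 0 / 2) x = 0 ∨
      deriv (fun y => max (D y) 0 / 2) x = deriv D x / 2 := by
  rcases le_or_gt (D x) 0 with h | h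
  -- The positive part attains its global minimum `0` at `x`, which also covers the possible corner
  -- at `D x = 0`.
  · refine Or.inl (IsLocalMin.deriv_eq_zero (Eventually.of_forall fun y => ?_))
    simp only [max_eq_right h]
    have := le_max_right (D y) 0
    linarith
  · right
    have : (fun y => max (D y) 0 / 2) =ᶠ[𝓝 x] fun y => D y / 2 := by
      filter_upwards [hD.continuousAt.eventually (lt_mem_nhds h)] with y hy
      rw [max_eq_left hy.le]
    rw [this.deriv_eq, deriv_div_const]

namespace TautString

/-- If moving `U` and `V` to their midpoint (up to the shift `c`) where `U - V > c` shortens neither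
graph, then `U - V ≤ c` everywhere. -/
theorem le_add_of_graphLength_le {U V : ℝ → ℝ} {c : ℝ}
    (hU : AbsolutelyContinuousOnInterval U 0 1) (hV : AbsolutelyContinuousOnInterval V 0 1)
    (h0 : U 0 ≤ V 0 + c)
    (hUP : graphLength U ≤ graphLength fun x => U x - max (U x - V x - c) 0 / 2)
    (hVP : graphLength V ≤ graphLength fun x => V x + max (U x - V x - c) 0 / 2)
    {x : ℝ} (hx : x ∈ Icc (0 : ℝ) 1) : U x ≤ V x + c := by
  set P : ℝ → ℝ := fun x => max (U x - V x - c) 0 / 2 with hPdef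
  have hP : AbsolutelyContinuousOnInterval P 0 1 := hU.max_sub_sub_zero_div_two hV c
  have hW : AbsolutelyContinuousOnInterval (fun x => U x - P x) 0 1 := hU.sub hP
  have hZ : AbsolutelyContinuousOnInterval (fun x => V x + P x) 0 1 := hV.add hP
  have iU := hU.intervalIntegrable_sqrt_one_add_deriv_sq
  have iV := hV.intervalIntegrable_sqrt_one_add_deriv_sq
  have iW := hW.intervalIntegrable_sqrt_one_add_deriv_sq
  have iZ := hZ.intervalIntegrable_sqrt_one_add_deriv_sq
  set G : ℝ → ℝ := fun x => (√(1 + deriv U x ^ 2) + √(1 + deriv V x ^ 2)) -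
    (√(1 + deriv (fun x => U x - P x) x ^ 2) + √(1 + deriv (fun x => V x + P x) x ^ 2)) with hG
  -- `G` is the pointwise saving in length: zero where `P' = 0`, strictly positive elsewhere.
  have key : ∀ᵐ x, x ∈ uIcc (0 : ℝ) 1 → 0 ≤ G x ∧ (G x = 0 → deriv P x = 0) := by
    filter_upwards [hU.ae_differentiableAt, hV.ae_differentiableAt, hP.ae_differentiableAt]
      with x dU dV dP hx
    replace dU := dU hx
    replace dV := dV hx
    replace dP := dP hx
    have hd : deriv P x = 0 ∨ deriv P x = (deriv U x - deriv V x) / 2 := by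
      have := deriv_max_zero_div_two ((dU.sub dV).sub_const c)
      rwa [deriv_sub_const, deriv_sub dU dV] at this
    simp only [hG]
    rw [deriv_fun_sub dU dP, deriv_fun_add dV dP]
    by_cases hz : deriv P x = 0
    · simp [hz]
    · have hd := hd.resolve_left hz
      have hne : deriv U x ≠ deriv V x := fun h => hz (by rw [hd, h]; simp)
      have hlt := Real.sqrt_one_add_sq_midpoint_lt hne
      rw [hd, show deriv U x - (deriv U x - deriv V x) / 2 = (deriv U x + deriv V x) / 2 by ring,
        show deriv V x + (deriv U x - deriv V x) / 2 = (deriv U x + deriv V x) / 2 by ring]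
      exact ⟨by linarith, fun h => by linarith⟩
  have iG : IntervalIntegrable G volume 0 1 := (iU.add iV).sub (iW.add iZ)
  have hG0 : 0 ≤ᵐ[volume.restrict (Ioc 0 1)] G := by
    refine (ae_restrict_iff' measurableSet_Ioc).mpr ?_
    filter_upwards [key] with y hy hy'
    exact (hy (by rw [uIcc_of_le zero_le_one]; exact Ioc_subset_Icc_self hy')).1
  -- The length hypotheses say that the total saving is at most zero, so `G` vanishes a.e.
  have hint : ∫ x in (0 : ℝ)..1, G x = 0 := by
    refine le_antisymm ?_ (intervalIntegral.integral_nonneg_of_ae_restrict zero_le_one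
      (by rwa [← restrict_Ioc_eq_restrict_Icc]))
    simp only [hG]
    rw [intervalIntegral.integral_sub (iU.add iV) (iW.add iZ), intervalIntegral.integral_add iU iV,
      intervalIntegral.integral_add iW iZ]
    unfold graphLength at hUP hVP
    linarith
  have hG' := (intervalIntegral.integral_eq_zero_iff_of_le_of_nonneg_ae zero_le_one hG0 iG).mp hint
  rw [Filter.EventuallyEq, ae_restrict_iff' measurableSet_Ioc] at hG'
  -- Absolute continuity of `P` turns `P' = 0` a.e. into `P x = P 0`.
  have hPx : ∫ y in (0 : ℝ)..x, deriv P y = 0 := by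
    refine intervalIntegral.integral_zero_ae ?_
    filter_upwards [key, hG'] with y hy hy' hmem
    rw [uIoc_of_le hx.1] at hmem
    have hmem' : y ∈ Ioc (0 : ℝ) 1 := ⟨hmem.1, hmem.2.trans hx.2⟩
    exact (hy (by rw [uIcc_of_le zero_le_one]; exact Ioc_subset_Icc_self hmem')).2 (hy' hmem')
  have hsub : uIcc 0 x ⊆ uIcc (0 : ℝ) 1 := by
    rw [uIcc_of_le hx.1, uIcc_of_le zero_le_one]
    exact Icc_subset_Icc_right hx.2
  rw [(hP.mono hsub).integral_deriv_eq_sub] at hPx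
  have hP0 : P 0 = 0 := by simp only [hPdef]; rw [max_eq_right (by linarith)]; simp
  have := le_max_left (U x - V x - c) 0
  simp only [hPdef] at hPx hP0
  linarith

/-- Taut strings for the same input depend on the tube radius in a `1`-Lipschitz way. -/
theorem IsTautString.le_add_abs_sub {f U V : ℝ → ℝ} {α β : ℝ} (hU : IsTautString f α U)
    (hV : IsTautString f β V) {x : ℝ} (hx : x ∈ Icc (0 : ℝ) 1) : U x ≤ V x + |α - β| := by
  obtain ⟨⟨acU, tU, U0, U1⟩, minU⟩ := hU
  obtain ⟨⟨acV, tV, V0, V1⟩, minV⟩ := hV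
  have hc := abs_nonneg (α - β)
  have hc1 := le_abs_self (α - β)
  have hc2 := neg_abs_le (α - β)
  have hP : AbsolutelyContinuousOnInterval
      (fun x => max (U x - V x - |α - β|) 0 / 2) 0 1 :=
    acU.max_sub_sub_zero_div_two acV _
  refine le_add_of_graphLength_le acU acV (by linarith) (minU ⟨acU.sub hP, ?_, ?_, ?_⟩)
    (minV ⟨acV.add hP, ?_, ?_, ?_⟩) hx
  -- Where `U - V > c`, the new curve lies between `V + c` and `U`, and `V + c ≥ F - β + |α - β| ≥ F
  -- - α`. The check for `V + P` below is symmetric.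
  · intro y hy
    obtain ⟨hu1, hu2⟩ := abs_le.mp (tU y hy)
    obtain ⟨hv1, hv2⟩ := abs_le.mp (tV y hy)
    rw [abs_le]
    rcases max_cases (U y - V y - |α - β|) 0 with h | h <;> constructor <;> linarith
  · simp [U0, V0]
  · simp [U1, V1]
  · intro y hy
    obtain ⟨hu1, hu2⟩ := abs_le.mp (tU y hy)
    obtain ⟨hv1, hv2⟩ := abs_le.mp (tV y hy)
    rw [abs_le]
    rcases max_cases (U y - V y - |α - β|) 0 with h | h <;> constructor <;> linarith
  · simp [U0, V0]
  · simp [U1, V1]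

end TautString

theorem theorem3p2 (f : ℝ → ℝ)
    (hf : MemLp f ⊤ (volume.restrict (Ioo (0 : ℝ) 1)))
    (hleft : ∀ x ∈ Ioo (0 : ℝ) 1, TautString.HasLeftApproxLimit f x)
    (hright : ∀ x ∈ Ioo (0 : ℝ) 1, TautString.HasRightApproxLimit f x)
    (α₁ α₂ : ℝ) (hα₁ : 0 < α₁) (hα : α₁ < α₂)
    (U₁ U₂ : ℝ → ℝ)
    (hU₁ : TautString.IsTautString f α₁ U₁)
    (hU₂ : TautString.IsTautString f α₂ U₂) :
    TautString.upperContactSet f α₂ U₂ ∪ TautString.lowerContactSet f α₂ U₂ ⊆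
      TautString.upperContactSet f α₁ U₁ ∪ TautString.lowerContactSet f α₁ U₁ := by
  have hc : |α₂ - α₁| = α₂ - α₁ := abs_of_pos (by linarith)
  rintro x (⟨hx, h⟩ | ⟨hx, h⟩)
  · refine Or.inl ⟨hx, ?_⟩
    -- The tube gives `U₁ ≤ F + α₁`; closeness gives `U₁ ≥ U₂ - (α₂ - α₁) = F + α₁`.
    have h₁ := (abs_le.mp (hU₁.1.2.1 x hx)).2
    have h₂ := hU₂.le_add_abs_sub hU₁ (Ioo_subset_Icc_self hx)
    linarith
  · refine Or.inr ⟨hx, ?_⟩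
    have h₁ := (abs_le.mp (hU₁.1.2.1 x hx)).1
    have h₂ := hU₁.le_add_abs_sub hU₂ (Ioo_subset_Icc_self hx)
    rw [abs_sub_comm] at h₂
    linarith
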